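/- Let $\mathbb{T}=\mathbb{R}/\mathbb{Z}$, and for $t\in\mathbb{R}$ write $t \bmod 1$ for the class $t+\mathbb{Z}\in\mathbb{T}$. An interval on $\mathbb{T}$ is the image of an interval of $\mathbb{R}$ under the canonical projection $\mathbb{R}\to\mathbb{T}$, and its length is its Lebesgue measure (normalized so that $\mathbb{T}$ has measure $1$). Fix an integer $p\ge 1$. There exists a constant $K_p\in(0,\infty)$ with the following property. For every sufficiently large integer $n$ there exist a set $P\subseteq\mathbb{Z}$ with $\operatorname{card} P=n$ and a real number $A$ such that for all $B_1,\dots,B_{p-1}\in\mathbb{R}$ the set $$\big\{(A k^p + B_{p-1}k^{p-1}+\cdots+B_1 k) \bmod 1 \,:\, k\in P\big\}\subseteq\mathbb{T}$$ intersects every interval on $\mathbb{T}$ of length $$\varepsilon_n = K_p\,\frac{\log n}{n},$$ where $\log$ is the natural logarithm. -/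

import Mathlib

/-- The torus `𝕋 = ℝ / ℤ` is Mathlib's `UnitAddCircle`, and `t mod 1` is the coercion of `t : ℝ`.
An interval on the torus is the image of an interval of `ℝ` (an order-connected set: open, closed
or half-open) under the canonical projection. -/
def IsTorusInterval (J : Set UnitAddCircle) : Prop :=
  ∃ I : Set ℝ, I.OrdConnected ∧ J = (fun t : ℝ => (t : UnitAddCircle)) '' I

/-!
Take `A = 1 / (q * p!)` with `q` a prime of polynomial size in `n`, and look for `P` inside
`[0, q ^ 2)`. For fixed `B` and a fixed arc of length of order `ε = K log n / n`, Weyl's inequality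
puts a proportion at least of order `ε` of the integers of `[0, q ^ 2)` into the arc, uniformly in
`B`. A random `n`-element choice therefore misses the arc with probability at most
`exp (-c ε n) = n ^ (-c K)`. Since `k` is polynomially bounded, it is enough to treat the `B` and the
arcs in a net of `n ^ O(1)` elements, and a union bound concludes when `K` is large. The centre of
the arc is treated as one more coefficient, of degree `0`.

* Weyl's inequality is `norm_sum_expTwoPiI_polynomial_le`. With leading coefficient `m / (q * d!)` and
  sums of length `q ^ 2`, it needs no divisor bounds and no logarithms: after differencing down to
  a linear phase with slope `m / q`, `q ∤ m`, the geometric sum is at most `2 q`.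
* The passage from exponential sums to counting is `card_filter_near_int_ge`. It multiplies the kernel
  `|∑ a j e (j x)| ^ 2`, `a j = sin (π (j + 1) / (M + 1))`, by `2 cos (2 π x) - 2 cos (2 π δ)`, which is
  nonpositive away from the `δ`-neighbourhood of `ℤ`. The choice of `a` makes the mean of the product
  positive with `M` as small as `1 / δ`, so that no power of `ε` is lost in the count.
* The union bound is replaced by the greedy selection `exists_card_le_and_card_filter_not_hit_le`, and
  the net is `exists_net_coeff`.
-/

/-! ### The additive character of `ℝ / ℤ` -/

/-- The character `x ↦ exp (2 π i x)` of `ℝ`, with values in `ℂ` rather than in `Circle`. -/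
noncomputable def expTwoPiI (x : ℝ) : ℂ := Complex.exp (((2 * Real.pi * x : ℝ) : ℂ) * Complex.I)

local notation "𝐞" => expTwoPiI

theorem expTwoPiI_add (x y : ℝ) : 𝐞 (x + y) = 𝐞 x * 𝐞 y := by
  unfold expTwoPiI
  rw [← Complex.exp_add]
  push_cast
  ring_nf

theorem expTwoPiI_zero : 𝐞 0 = 1 := by simp [expTwoPiI]

theorem norm_expTwoPiI (x : ℝ) : ‖𝐞 x‖ = 1 := Complex.norm_exp_ofReal_mul_I _

theorem conj_expTwoPiI (x : ℝ) : (starRingEnd ℂ) (𝐞 x) = 𝐞 (-x) := by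
  unfold expTwoPiI
  rw [← Complex.exp_conj]
  simp [map_ofNat]

theorem expTwoPiI_int (n : ℤ) : 𝐞 n = 1 := by
  unfold expTwoPiI
  rw [Complex.exp_eq_one_iff]
  exact ⟨n, by push_cast; ring⟩

theorem expTwoPiI_natCast_mul (n : ℕ) (x : ℝ) : 𝐞 (n * x) = 𝐞 x ^ n := by
  unfold expTwoPiI
  rw [← Complex.exp_nat_mul]
  push_cast
  ring_nf

theorem expTwoPiI_eq_one_iff (x : ℝ) : 𝐞 x = 1 ↔ ∃ n : ℤ, x = n := by
  constructor
  · intro h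
    obtain ⟨n, hn⟩ := Complex.exp_eq_one_iff.1 h
    refine ⟨n, ?_⟩
    have h2 : ((2 * Real.pi * x : ℝ) : ℂ) = ((n * (2 * Real.pi) : ℝ) : ℂ) := by
      apply mul_right_cancel₀ Complex.I_ne_zero
      rw [hn]
      push_cast
      ring
    have h3 : 2 * Real.pi * x = n * (2 * Real.pi) := by exact_mod_cast h2
    have := Real.pi_pos
    apply mul_left_cancel₀ (by positivity : 2 * Real.pi ≠ 0)
    linarith
  · rintro ⟨n, rfl⟩
    exact expTwoPiI_int n

theorem expTwoPiI_add_expTwoPiI_neg (x : ℝ) :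
    𝐞 x + 𝐞 (-x) = ((2 * Real.cos (2 * Real.pi * x) : ℝ) : ℂ) := by
  unfold expTwoPiI
  push_cast
  rw [Complex.two_cos]
  ring_nf

/-! ### Weyl's inequality -/

/-- If `ζ ≠ 1` is a `q`-th root of unity then the vanishing of `∑ ζ ^ j` keeps `ζ` at distance at
least `1 / q` from `1`. -/
theorem one_le_mul_norm_sub_one {ζ : ℂ} {q : ℕ} (hq : 0 < q) (h1 : ζ ^ q = 1) (hne : ζ ≠ 1)
    (hn : ‖ζ‖ = 1) : 1 ≤ q * ‖ζ - 1‖ := by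
  -- Summing `1 - ζ ^ j` over `j < q` gives exactly `q`.
  have hs : ∑ j ∈ Finset.range q, ζ ^ j = 0 := by
    rw [geom_sum_eq hne, h1, sub_self, zero_div]
  have hj : ∀ j : ℕ, ‖ζ ^ j - 1‖ ≤ j * ‖ζ - 1‖ := by
    intro j
    rw [← mul_geom_sum, norm_mul, mul_comm]
    gcongr
    refine (norm_sum_le _ _).trans ?_
    simp [hn]
  have h2 : (q : ℝ) ≤ q * (q * ‖ζ - 1‖) := by
    calc (q : ℝ) = ‖∑ j ∈ Finset.range q, (ζ ^ j - 1)‖ := by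
          rw [Finset.sum_sub_distrib, hs]; simp
      _ ≤ ∑ j ∈ Finset.range q, ‖ζ ^ j - 1‖ := norm_sum_le _ _
      _ ≤ ∑ j ∈ Finset.range q, (q : ℝ) * ‖ζ - 1‖ := by
          refine Finset.sum_le_sum fun j hjq => (hj j).trans ?_
          have := (Finset.mem_range.1 hjq).le
          gcongr
      _ = _ := by simp
  have hq' : (0 : ℝ) < q := by exact_mod_cast hq
  nlinarith

theorem norm_sum_expTwoPiI_linear_le {q : ℕ} (hq : 0 < q) {m : ℤ} (hm : ¬ (q : ℤ) ∣ m) (c : ℝ)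
    (a b : ℤ) : ‖∑ k ∈ Finset.Ico a b, 𝐞 (c + m / q * k)‖ ≤ 2 * q := by
  rcases le_total b a with hab | hab
  · simp [Finset.Ico_eq_empty_of_le hab]
  obtain ⟨n, rfl⟩ := Int.exists_add_of_le hab
  have hq' : (0 : ℝ) < q := by exact_mod_cast hq
  set ζ := 𝐞 (m / q) with hζ
  have h1 : ζ ^ q = 1 := by
    rw [hζ, ← expTwoPiI_natCast_mul, mul_div_cancel₀ _ hq'.ne']
    exact expTwoPiI_int m
  have hne : ζ ≠ 1 := by
    intro h
    obtain ⟨z, hz⟩ := (expTwoPiI_eq_one_iff _).1 h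
    apply hm
    refine ⟨z, ?_⟩
    field_simp at hz
    exact_mod_cast hz
  have hlow := one_le_mul_norm_sub_one hq h1 hne (norm_expTwoPiI _)
  have hsum : ∑ k ∈ Finset.Ico a (a + n), 𝐞 (c + m / q * k) =
      𝐞 (c + m / q * a) * ∑ j ∈ Finset.range n, ζ ^ j := by
    rw [Finset.mul_sum]
    refine (Finset.sum_bij (fun (j : ℕ) _ => a + (j : ℤ)) ?_ ?_ ?_ ?_).symm
    · intro j hj
      have := Finset.mem_range.1 hj
      simp only [Finset.mem_Ico]
      omega
    · intro i _ j _ h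
      simpa using h
    · intro k hk
      have := Finset.mem_Ico.1 hk
      exact ⟨(k - a).toNat, by simp only [Finset.mem_range]; omega, by omega⟩
    · intro j _
      rw [hζ, ← expTwoPiI_natCast_mul, ← expTwoPiI_add]
      push_cast
      ring_nf
  rw [hsum, norm_mul, norm_expTwoPiI, one_mul]
  have h2 : ‖∑ j ∈ Finset.range n, ζ ^ j‖ * ‖ζ - 1‖ ≤ 2 := by
    rw [← norm_mul, geom_sum_mul]
    refine (norm_sub_le _ _).trans ?_
    rw [norm_pow, norm_expTwoPiI]
    norm_num
  nlinarith [norm_nonneg (∑ j ∈ Finset.range n, ζ ^ j), norm_nonneg (ζ - 1)]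

/-- The Weyl–van der Corput step: the square of an exponential sum over an interval of length at
most `N` is bounded by the sums of the differenced phases over subintervals. -/
theorem norm_sq_sum_expTwoPiI_le (g : ℤ → ℝ) (a b : ℤ) {N : ℕ} (hN : b - a ≤ N) :
    ‖∑ k ∈ Finset.Ico a b, 𝐞 (g k)‖ ^ 2 ≤ ∑ h ∈ Finset.Ioo (-(N : ℤ)) N,
      ‖∑ k ∈ Finset.Ico (max a (a - h)) (min b (b - h)), 𝐞 (g (k + h) - g k)‖ := by
  have key : ((‖∑ k ∈ Finset.Ico a b, 𝐞 (g k)‖ ^ 2 : ℝ) : ℂ) = ∑ h ∈ Finset.Ioo (-(N : ℤ)) N,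
      ∑ k ∈ Finset.Ico (max a (a - h)) (min b (b - h)), 𝐞 (g (k + h) - g k) := by
    have h1 : ((‖∑ k ∈ Finset.Ico a b, 𝐞 (g k)‖ ^ 2 : ℝ) : ℂ) =
        ∑ k ∈ Finset.Ico a b, ∑ l ∈ Finset.Ico a b, 𝐞 (g l - g k) := by
      push_cast
      rw [← Complex.conj_mul', map_sum, Finset.sum_mul_sum]
      refine Finset.sum_congr rfl fun k _ => Finset.sum_congr rfl fun l _ => ?_
      rw [conj_expTwoPiI, ← expTwoPiI_add]
      ring_nf
    rw [h1, Finset.sum_sigma', Finset.sum_sigma']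
    refine Finset.sum_bij' (fun x _ => ⟨x.2 - x.1, x.1⟩) (fun x _ => ⟨x.2, x.2 + x.1⟩) ?_ ?_ ?_ ?_ ?_
    · rintro ⟨k, l⟩ h
      simp only [Finset.mem_sigma, Finset.mem_Ico, Finset.mem_Ioo] at h ⊢
      omega
    · rintro ⟨k, l⟩ h
      simp only [Finset.mem_sigma, Finset.mem_Ico, Finset.mem_Ioo] at h ⊢
      omega
    · rintro ⟨k, l⟩ h
      simp
    · rintro ⟨k, l⟩ h
      simp
    · rintro ⟨k, l⟩ h
      simp
  have : ‖∑ k ∈ Finset.Ico a b, 𝐞 (g k)‖ ^ 2 =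
      ‖((‖∑ k ∈ Finset.Ico a b, 𝐞 (g k)‖ ^ 2 : ℝ) : ℂ)‖ := by
    rw [Complex.norm_real, Real.norm_of_nonneg (by positivity)]
  rw [this, key]
  exact norm_sum_le _ _

theorem natDegree_taylor_sub_le {f : Polynomial ℝ} {d : ℕ} (hf : f.natDegree ≤ d + 1) (r : ℝ) :
    (Polynomial.taylor r f - f).natDegree ≤ d := by
  rw [Polynomial.natDegree_le_iff_coeff_eq_zero]
  intro n hn
  have hn' : d + 1 ≤ n := hn
  rw [Polynomial.coeff_sub, Polynomial.taylor_coeff, Polynomial.eq_C_of_natDegree_le_zero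
    (p := Polynomial.hasseDeriv n f) ((Polynomial.natDegree_hasseDeriv_le _ _).trans (by omega))]
  simp [Polynomial.hasseDeriv_coeff]

theorem coeff_taylor_sub {f : Polynomial ℝ} {d : ℕ} (hf : f.natDegree ≤ d + 1) (r : ℝ) :
    (Polynomial.taylor r f - f).coeff d = (d + 1) * r * f.coeff (d + 1) := by
  have h : (Polynomial.hasseDeriv d f).natDegree < 2 :=
    (Polynomial.natDegree_hasseDeriv_le _ _).trans_lt (by omega)
  rw [Polynomial.coeff_sub, Polynomial.taylor_coeff, Polynomial.eval_eq_sum_range' h]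
  simp [Finset.sum_range_succ, Polynomial.hasseDeriv_coeff, add_comm 1 d]
  ring

theorem card_filter_dvd_Ioo_le {q : ℕ} (hq : 0 < q) :
    ((Finset.Ioo (-((q ^ 2 : ℕ) : ℤ)) ((q ^ 2 : ℕ) : ℤ)).filter fun h => (q : ℤ) ∣ h).card
      ≤ 2 * q := by
  have hsub : (Finset.Ioo (-((q ^ 2 : ℕ) : ℤ)) ((q ^ 2 : ℕ) : ℤ)).filter (fun h => (q : ℤ) ∣ h) ⊆
      (Finset.Ioo (-(q : ℤ)) q).image fun t => (q : ℤ) * t := by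
    intro h hh
    simp only [Finset.mem_filter, Finset.mem_Ioo] at hh
    obtain ⟨⟨h1, h2⟩, t, rfl⟩ := hh
    simp only [Finset.mem_image, Finset.mem_Ioo]
    have hq' : (0 : ℤ) < q := by exact_mod_cast hq
    push_cast at h1 h2
    exact ⟨t, ⟨by nlinarith, by nlinarith⟩, rfl⟩
  refine (Finset.card_le_card hsub).trans (Finset.card_image_le.trans ?_)
  simp only [Int.card_Ioo]
  omega

/-- Weyl's inequality for a phase whose leading coefficient times `(d + 1)!` is a fraction `m / q`
with prime denominator. Intervals have length up to `q ^ 2`, so that the linear case already saves a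
factor `q` and only a proportion `2 / q` of the differencing shifts is degenerate. -/
theorem norm_sum_expTwoPiI_polynomial_le {q : ℕ} (hq : q.Prime) (d : ℕ) :
    ∀ (R : ℝ), 1 ≤ R → R ^ (2 ^ d) ≤ q → ∀ (f : Polynomial ℝ) (m : ℤ), f.natDegree ≤ d + 1 →
      f.coeff (d + 1) * (d + 1).factorial = m / q → ¬ (q : ℤ) ∣ m →
      ∀ a b : ℤ, b - a ≤ ((q ^ 2 : ℕ) : ℤ) →
        ‖∑ k ∈ Finset.Ico a b, 𝐞 (f.eval (k : ℝ))‖ ≤ 5 * q ^ 2 / R := by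
  have hq0 : (0 : ℝ) < q := by exact_mod_cast hq.pos
  induction d with
  | zero =>
    intro R hR hRq f m hf hcoeff hm a b _
    simp only [pow_zero, pow_one] at hRq
    have hev : ∀ k : ℤ, f.eval (k : ℝ) = f.coeff 0 + m / q * k := by
      intro k
      rw [Polynomial.eval_eq_sum_range' (n := 2) (by omega), ← hcoeff]
      simp [Finset.sum_range_succ]
    simp only [hev]
    refine (norm_sum_expTwoPiI_linear_le hq.pos hm _ a b).trans ?_
    rw [le_div_iff₀ (by linarith)]
    nlinarith
  | succ d ih =>
    intro R hR hRq f m hf hcoeff hm a b hab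
    have hR2 : (R ^ 2) ^ (2 ^ d) ≤ q := by
      rw [← pow_mul, ← pow_succ']
      exact hRq
    have hR1 : 1 ≤ R ^ 2 := one_le_pow₀ hR
    have hR2q : R ^ 2 ≤ q := (le_self_pow₀ hR1 (by positivity)).trans hR2
    have hlen : ∀ h : ℤ, min b (b - h) - max a (a - h) ≤ ((q ^ 2 : ℕ) : ℤ) := by
      intro h
      omega
    -- A shift `h` prime to `q` keeps the phase nondegenerate; the others are rare.
    have hgood : ∀ h : ℤ, ¬ (q : ℤ) ∣ h →
        ‖∑ k ∈ Finset.Ico (max a (a - h)) (min b (b - h)),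
          𝐞 (f.eval ((k + h : ℤ) : ℝ) - f.eval (k : ℝ))‖ ≤ 5 * q ^ 2 / R ^ 2 := by
      intro h hh
      have := ih (R ^ 2) hR1 hR2 (Polynomial.taylor (h : ℝ) f - f) (h * m)
        (natDegree_taylor_sub_le hf _) (by
          rw [coeff_taylor_sub hf]
          rw [Nat.factorial_succ (d + 1)] at hcoeff
          push_cast at hcoeff ⊢
          linear_combination (h : ℝ) * hcoeff)
        (fun hd => ((Nat.prime_iff_prime_int.1 hq).dvd_or_dvd hd).elim hh hm) _ _ (hlen h)
      simpa [Polynomial.taylor_eval] using this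
    have hbad : ∀ h : ℤ, ‖∑ k ∈ Finset.Ico (max a (a - h)) (min b (b - h)),
          𝐞 (f.eval ((k + h : ℤ) : ℝ) - f.eval (k : ℝ))‖ ≤ q ^ 2 := by
      intro h
      refine (norm_sum_le _ _).trans ?_
      simp only [norm_expTwoPiI, Finset.sum_const, Int.card_Ico, nsmul_eq_mul, mul_one]
      have := hlen h
      have h2 : (min b (b - h) - max a (a - h)).toNat ≤ q ^ 2 := by omega
      exact_mod_cast h2
    have hsq := norm_sq_sum_expTwoPiI_le (fun k => f.eval (k : ℝ)) a b hab
    have hcard := card_filter_dvd_Ioo_le hq.pos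
    rw [← Finset.sum_filter_add_sum_filter_not (Finset.Ioo (-((q ^ 2 : ℕ) : ℤ)) ((q ^ 2 : ℕ) : ℤ))
      (fun h : ℤ => (q : ℤ) ∣ h)] at hsq
    have hs1 := Finset.sum_le_card_nsmul _ _ _ fun h (_ : h ∈ (Finset.Ioo (-((q ^ 2 : ℕ) : ℤ))
      ((q ^ 2 : ℕ) : ℤ)).filter fun h => (q : ℤ) ∣ h) => hbad h
    have hs2 := Finset.sum_le_card_nsmul _ _ _ fun h (hh : h ∈ (Finset.Ioo (-((q ^ 2 : ℕ) : ℤ))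
      ((q ^ 2 : ℕ) : ℤ)).filter fun h => ¬ (q : ℤ) ∣ h) => hgood h (Finset.mem_filter.1 hh).2
    have hcard2 : ((Finset.Ioo (-((q ^ 2 : ℕ) : ℤ)) ((q ^ 2 : ℕ) : ℤ)).filter
        fun h => ¬ (q : ℤ) ∣ h).card ≤ 2 * q ^ 2 := by
      refine (Finset.card_filter_le _ _).trans ?_
      simp only [Int.card_Ioo]
      omega
    rw [nsmul_eq_mul] at hs1 hs2
    have hs1' := hs1.trans (mul_le_mul_of_nonneg_right
      (show _ ≤ ((2 * q : ℕ) : ℝ) from by exact_mod_cast hcard) (by positivity))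
    have hs2' := hs2.trans (mul_le_mul_of_nonneg_right
      (show _ ≤ ((2 * q ^ 2 : ℕ) : ℝ) from by exact_mod_cast hcard2) (by positivity))
    have htot := hsq.trans (add_le_add hs1' hs2')
    refine (sq_le_sq₀ (norm_nonneg _) (by positivity)).1 (htot.trans ?_)
    push_cast
    rw [div_pow]
    have e1 : 2 * (q : ℝ) * q ^ 2 ≤ 2 * q ^ 4 / R ^ 2 := by
      rw [le_div_iff₀ (by positivity)]
      nlinarith [pow_pos hq0 3]
    have e2 : 2 * (q : ℝ) ^ 2 * (5 * q ^ 2 / R ^ 2) = 10 * q ^ 4 / R ^ 2 := by ring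
    have e3 : (5 * (q : ℝ) ^ 2) ^ 2 / R ^ 2 = 25 * q ^ 4 / R ^ 2 := by ring
    have e4 : 2 * (q : ℝ) ^ 4 / R ^ 2 + 10 * q ^ 4 / R ^ 2 = 12 * q ^ 4 / R ^ 2 := by ring
    rw [e2, e3]
    refine (add_le_add_left e1 _).trans ?_
    rw [e4]
    gcongr
    norm_num

/-! ### From exponential sums to counting near the integers -/

/-- Coefficients `a j = sin (π (j + 1) / (M + 1))` of the Fejér kernel extremal for its first
Fourier coefficient. -/
noncomputable def fejerCoeff (M j : ℕ) : ℝ := Real.sin (Real.pi / (M + 1) * (j + 1))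

theorem fejerCoeff_self (M : ℕ) : fejerCoeff M M = 0 := by
  unfold fejerCoeff
  rw [div_mul_cancel₀ _ (by positivity), Real.sin_pi]

theorem abs_fejerCoeff_le (M j : ℕ) : |fejerCoeff M j| ≤ 1 := Real.abs_sin_le_one _

/-- The recurrence `a (j + 1) + a (j - 1) = 2 cos θ a j`, `θ = π / (M + 1)`, with zero boundary terms,
summed against `a j`. -/
theorem sum_fejerCoeff_mul_succ (M : ℕ) :
    ∑ j ∈ Finset.range M, fejerCoeff M j * fejerCoeff M (j + 1) =
      Real.cos (Real.pi / (M + 1)) * ∑ j ∈ Finset.range M, fejerCoeff M j ^ 2 := by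
  have h1 : ∀ n : ℕ, 2 * ∑ j ∈ Finset.range n, fejerCoeff M j * fejerCoeff M (j + 1) =
      2 * (Real.cos (Real.pi / (M + 1)) * ∑ j ∈ Finset.range n, fejerCoeff M j ^ 2) +
        Real.sin (Real.pi / (M + 1) * n) * fejerCoeff M n := by
    intro n
    induction n with
    | zero => simp
    | succ n ih =>
      rw [Finset.sum_range_succ, Finset.sum_range_succ]
      have h2 : fejerCoeff M (n + 1) + Real.sin (Real.pi / (M + 1) * n) =
          2 * Real.cos (Real.pi / (M + 1)) * fejerCoeff M n := by
        unfold fejerCoeff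
        push_cast
        have e1 : Real.pi / ((M : ℝ) + 1) * (n + 1 + 1) =
          Real.pi / ((M : ℝ) + 1) * (n + 1) + Real.pi / ((M : ℝ) + 1) := by ring
        have e2 : Real.pi / ((M : ℝ) + 1) * n =
          Real.pi / ((M : ℝ) + 1) * (n + 1) - Real.pi / ((M : ℝ) + 1) := by ring
        rw [e1, e2, Real.sin_add, Real.sin_sub]
        ring
      have h3 : Real.sin (Real.pi / (M + 1) * ((n + 1 : ℕ) : ℝ)) = fejerCoeff M n := by
        unfold fejerCoeff
        push_cast
        rfl
      rw [h3]
      linear_combination ih + fejerCoeff M n * h2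
  have := h1 M
  rw [fejerCoeff_self, mul_zero, add_zero] at this
  linarith

theorem four_le_sq_mul_sum_sq_fejerCoeff {M : ℕ} (hM : 1 ≤ M) :
    4 ≤ ((M : ℝ) + 1) ^ 2 * ∑ j ∈ Finset.range M, fejerCoeff M j ^ 2 := by
  have hM' : (1 : ℝ) ≤ M := by exact_mod_cast hM
  have h0 : fejerCoeff M 0 ^ 2 ≤ ∑ j ∈ Finset.range M, fejerCoeff M j ^ 2 :=
    Finset.single_le_sum (f := fun j => fejerCoeff M j ^ 2) (fun j _ => sq_nonneg _)
      (Finset.mem_range.2 hM)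
  have h1 : 2 / ((M : ℝ) + 1) ≤ fejerCoeff M 0 := by
    unfold fejerCoeff
    have h2 : Real.pi / ((M : ℝ) + 1) ≤ Real.pi / 2 := by
      have := Real.pi_pos
      gcongr
      linarith
    have h3 := Real.mul_le_sin (x := Real.pi / ((M : ℝ) + 1)) (by positivity) h2
    have h4 : 2 / Real.pi * (Real.pi / ((M : ℝ) + 1)) = 2 / ((M : ℝ) + 1) := by
      field_simp
    simpa [h4] using h3
  have h5 : (2 / ((M : ℝ) + 1)) ^ 2 ≤ ∑ j ∈ Finset.range M, fejerCoeff M j ^ 2 :=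
    (pow_le_pow_left₀ (by positivity) h1 2).trans h0
  rw [div_pow, div_le_iff₀ (by positivity)] at h5
  linarith

/-- The nonnegative trigonometric polynomial `|∑ a j e (j x)| ^ 2` with the coefficients
`fejerCoeff M`; it is not normalized to have mean `1`. -/
noncomputable def fejerKernel (M : ℕ) (x : ℝ) : ℝ :=
  ‖∑ j ∈ Finset.range M, (fejerCoeff M j : ℂ) * 𝐞 (j * x)‖ ^ 2

theorem fejerKernel_le (M : ℕ) (x : ℝ) :
    fejerKernel M x ≤ M * ∑ j ∈ Finset.range M, fejerCoeff M j ^ 2 := by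
  have h1 : ‖∑ j ∈ Finset.range M, (fejerCoeff M j : ℂ) * 𝐞 (j * x)‖ ≤
      ∑ j ∈ Finset.range M, |fejerCoeff M j| := by
    refine (norm_sum_le _ _).trans (le_of_eq ?_)
    simp [norm_expTwoPiI]
  refine (pow_le_pow_left₀ (norm_nonneg _) h1 2).trans ?_
  refine sq_sum_le_card_mul_sum_sq.trans ?_
  simp

theorem fejerKernel_eq_sum (M : ℕ) (x : ℝ) :
    (fejerKernel M x : ℂ) = ∑ j ∈ Finset.range M, ∑ l ∈ Finset.range M,
      ((fejerCoeff M j * fejerCoeff M l : ℝ) : ℂ) * 𝐞 ((((l : ℤ) - j : ℤ) : ℝ) * x) := by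
  unfold fejerKernel
  push_cast
  rw [← Complex.conj_mul', map_sum, Finset.sum_mul_sum]
  refine Finset.sum_congr rfl fun j _ => Finset.sum_congr rfl fun l _ => ?_
  rw [map_mul, conj_expTwoPiI, Complex.conj_ofReal]
  have : ((l : ℝ) - j) * x = -(j * x) + l * x := by ring
  rw [this, expTwoPiI_add]
  ring

/-- Fourier expansion of a trigonometric polynomial that, for `0 ≤ γ ≤ π`, is positive only within
`γ / 2π` of an integer. -/
theorem fejerKernel_mul_eq_sum (M : ℕ) (γ x : ℝ) :
    ((fejerKernel M x * (2 * Real.cos (2 * Real.pi * x) - 2 * Real.cos γ) : ℝ) : ℂ) =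
      ∑ j ∈ Finset.range M, ∑ l ∈ Finset.range M, ((fejerCoeff M j * fejerCoeff M l : ℝ) : ℂ) *
        (𝐞 ((((l : ℤ) - j + 1 : ℤ) : ℝ) * x) + 𝐞 ((((l : ℤ) - j - 1 : ℤ) : ℝ) * x)
          - (2 * Real.cos γ : ℝ) * 𝐞 ((((l : ℤ) - j : ℤ) : ℝ) * x)) := by
  rw [Complex.ofReal_mul, fejerKernel_eq_sum, Complex.ofReal_sub, ← expTwoPiI_add_expTwoPiI_neg,
    Finset.sum_mul]
  refine Finset.sum_congr rfl fun j _ => ?_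
  rw [Finset.sum_mul]
  refine Finset.sum_congr rfl fun l _ => ?_
  have e1 : (((l : ℤ) - j + 1 : ℤ) : ℝ) * x = (((l : ℤ) - j : ℤ) : ℝ) * x + x := by
    push_cast; ring
  have e2 : (((l : ℤ) - j - 1 : ℤ) : ℝ) * x = (((l : ℤ) - j : ℤ) : ℝ) * x + -x := by
    push_cast; ring
  rw [e1, e2, expTwoPiI_add, expTwoPiI_add]
  ring

/-- The constant term of `fejerKernel M x * (2 cos (2 π x) - 2 cos γ)`. -/
theorem sum_sum_fejerCoeff_diag (M : ℕ) (γ : ℝ) :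
    ∑ j ∈ Finset.range M, ∑ l ∈ Finset.range M, fejerCoeff M j * fejerCoeff M l *
      ((if (l : ℤ) - j + 1 = 0 then 1 else 0) + (if (l : ℤ) - j - 1 = 0 then 1 else 0)
        - 2 * Real.cos γ * (if (l : ℤ) - j = 0 then 1 else 0)) =
      2 * (Real.cos (Real.pi / (M + 1)) - Real.cos γ) *
        ∑ j ∈ Finset.range M, fejerCoeff M j ^ 2 := by
  -- The index `l = j + 1` may equal `M`, outside the range, but `fejerCoeff M M = 0`.
  have hup : ∀ j ∈ Finset.range M, ∑ l ∈ Finset.range M, fejerCoeff M j * fejerCoeff M l *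
      (if (l : ℤ) - j - 1 = 0 then (1 : ℝ) else 0) = fejerCoeff M j * fejerCoeff M (j + 1) := by
    intro j hj
    have hjM := Finset.mem_range.1 hj
    rw [Finset.sum_congr rfl (g := fun l => if l = j + 1 then fejerCoeff M j * fejerCoeff M l else 0)
      (fun l _ => by
        by_cases h : l = j + 1
        · simp [h]
        · rw [if_neg h, if_neg (by omega), mul_zero])]
    rw [Finset.sum_ite_eq']
    split_ifs with h
    · rfl
    · have : j + 1 = M := by
        simp only [Finset.mem_range] at h
        omega
      rw [this, fejerCoeff_self, mul_zero]
  have hdiag : ∀ j ∈ Finset.range M, ∑ l ∈ Finset.range M, fejerCoeff M j * fejerCoeff M l *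
      (if (l : ℤ) - j = 0 then (1 : ℝ) else 0) = fejerCoeff M j ^ 2 := by
    intro j hj
    rw [Finset.sum_congr rfl (g := fun l => if l = j then fejerCoeff M j * fejerCoeff M l else 0)
      (fun l _ => by
        by_cases h : l = j
        · simp [h]
        · rw [if_neg h, if_neg (by omega), mul_zero])]
    rw [Finset.sum_ite_eq', if_pos hj, sq]
  have hdown : ∑ j ∈ Finset.range M, ∑ l ∈ Finset.range M, fejerCoeff M j * fejerCoeff M l *
      (if (l : ℤ) - j + 1 = 0 then (1 : ℝ) else 0) =
      ∑ j ∈ Finset.range M, fejerCoeff M j * fejerCoeff M (j + 1) := by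
    rw [Finset.sum_comm, ← Finset.sum_congr rfl hup]
    refine Finset.sum_congr rfl fun j _ => Finset.sum_congr rfl fun l _ => ?_
    rw [mul_comm (fejerCoeff M l)]
    congr 1
    exact if_congr (by omega) rfl rfl
  have hsplit : ∀ j l : ℕ, fejerCoeff M j * fejerCoeff M l *
      ((if (l : ℤ) - j + 1 = 0 then 1 else 0) + (if (l : ℤ) - j - 1 = 0 then 1 else 0)
        - 2 * Real.cos γ * (if (l : ℤ) - j = 0 then 1 else 0)) =
      fejerCoeff M j * fejerCoeff M l * (if (l : ℤ) - j + 1 = 0 then 1 else 0) +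
      fejerCoeff M j * fejerCoeff M l * (if (l : ℤ) - j - 1 = 0 then 1 else 0) -
      2 * Real.cos γ *
        (fejerCoeff M j * fejerCoeff M l * (if (l : ℤ) - j = 0 then 1 else 0)) := by
    intro j l
    ring
  have hdiag' : ∀ j ∈ Finset.range M, ∑ l ∈ Finset.range M, 2 * Real.cos γ *
      (fejerCoeff M j * fejerCoeff M l * (if (l : ℤ) - j = 0 then (1 : ℝ) else 0)) =
      2 * Real.cos γ * fejerCoeff M j ^ 2 := by
    intro j hj
    rw [← Finset.mul_sum, hdiag j hj]
  simp only [hsplit, Finset.sum_add_distrib, Finset.sum_sub_distrib]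
  rw [hdown, Finset.sum_congr rfl hup, Finset.sum_congr rfl hdiag', ← Finset.mul_sum,
    sum_fejerCoeff_mul_succ]
  ring

/-- Over points with small exponential sums, the sum of the kernel times
`2 cos (2 π x) - 2 cos γ` is close to the number of points times the constant term. -/
theorem sum_fejerKernel_mul_ge {ι : Type*} (s : Finset ι) (x : ι → ℝ) (M : ℕ) (γ E : ℝ)
    (hE : ∀ h : ℤ, h ≠ 0 → |h| ≤ M → ‖∑ k ∈ s, 𝐞 (h * x k)‖ ≤ E) :
    s.card * (2 * (Real.cos (Real.pi / (M + 1)) - Real.cos γ) *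
        ∑ j ∈ Finset.range M, fejerCoeff M j ^ 2) - 4 * M ^ 2 * E ≤
      ∑ k ∈ s, fejerKernel M (x k) * (2 * Real.cos (2 * Real.pi * x k) - 2 * Real.cos γ) := by
  rcases Nat.eq_zero_or_pos M with rfl | hM
  · simp [fejerKernel]
  have hE0 : 0 ≤ E := (norm_nonneg _).trans (hE 1 one_ne_zero (by
    rw [abs_one]; exact_mod_cast hM))
  set T : ℝ := ∑ k ∈ s, fejerKernel M (x k) * (2 * Real.cos (2 * Real.pi * x k) - 2 * Real.cos γ)
  -- `S' h` is the exponential sum at frequency `h` without its main term, present at `h = 0` only.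
  set S' : ℤ → ℂ := fun h => ∑ k ∈ s, 𝐞 (h * x k) - s.card * ((if h = 0 then 1 else 0 : ℝ) : ℂ)
    with hS'
  have hS'E : ∀ h : ℤ, |h| ≤ M → ‖S' h‖ ≤ E := by
    intro h hh
    rw [hS']
    by_cases h0 : h = 0
    · simp [h0, expTwoPiI_zero, hE0]
    · simpa [h0] using hE h h0 hh
  have hkey : ((T - s.card * (2 * (Real.cos (Real.pi / (M + 1)) - Real.cos γ) *
        ∑ j ∈ Finset.range M, fejerCoeff M j ^ 2) : ℝ) : ℂ) =
      ∑ j ∈ Finset.range M, ∑ l ∈ Finset.range M, ((fejerCoeff M j * fejerCoeff M l : ℝ) : ℂ) *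
        (S' ((l : ℤ) - j + 1) + S' ((l : ℤ) - j - 1) - (2 * Real.cos γ : ℝ) * S' ((l : ℤ) - j)) := by
    rw [← sum_sum_fejerCoeff_diag, Complex.ofReal_sub, Complex.ofReal_sum]
    simp only [fejerKernel_mul_eq_sum]
    rw [Finset.sum_comm]
    simp only [Finset.sum_comm (s := s)]
    rw [Complex.ofReal_mul (s.card : ℝ), Complex.ofReal_sum, Finset.mul_sum, ← Finset.sum_sub_distrib]
    refine Finset.sum_congr rfl fun j _ => ?_
    rw [Complex.ofReal_sum, Finset.mul_sum, ← Finset.sum_sub_distrib]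
    refine Finset.sum_congr rfl fun l _ => ?_
    rw [← Finset.mul_sum, Finset.sum_sub_distrib, Finset.sum_add_distrib, ← Finset.mul_sum, hS']
    push_cast
    ring
  have hbound : |T - s.card * (2 * (Real.cos (Real.pi / (M + 1)) - Real.cos γ) *
        ∑ j ∈ Finset.range M, fejerCoeff M j ^ 2)| ≤ 4 * M ^ 2 * E := by
    rw [← Real.norm_eq_abs, ← Complex.norm_real, hkey]
    have hterm : ∀ j ∈ Finset.range M, ∀ l ∈ Finset.range M,
        ‖((fejerCoeff M j * fejerCoeff M l : ℝ) : ℂ) *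
        (S' ((l : ℤ) - j + 1) + S' ((l : ℤ) - j - 1) - (2 * Real.cos γ : ℝ) * S' ((l : ℤ) - j))‖
          ≤ 4 * E := by
      intro j hj l hl
      have hj' := Finset.mem_range.1 hj
      have hl' := Finset.mem_range.1 hl
      have b1 := hS'E ((l : ℤ) - j + 1) (by rw [abs_le]; omega)
      have b2 := hS'E ((l : ℤ) - j - 1) (by rw [abs_le]; omega)
      have b3 := hS'E ((l : ℤ) - j) (by rw [abs_le]; omega)
      rw [norm_mul, Complex.norm_real, Real.norm_eq_abs, abs_mul]
      have c1 : |fejerCoeff M j| * |fejerCoeff M l| ≤ 1 :=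
        mul_le_one₀ (abs_fejerCoeff_le _ _) (abs_nonneg _) (abs_fejerCoeff_le _ _)
      have c2 : ‖((2 * Real.cos γ : ℝ) : ℂ)‖ ≤ 2 := by
        rw [Complex.norm_real, Real.norm_eq_abs, abs_mul, abs_two]
        linarith [Real.abs_cos_le_one γ]
      have c3 : ‖S' ((l : ℤ) - j + 1) + S' ((l : ℤ) - j - 1)
          - (2 * Real.cos γ : ℝ) * S' ((l : ℤ) - j)‖ ≤ 4 * E := by
        refine (norm_sub_le _ _).trans ?_
        rw [norm_mul]
        have := mul_le_mul c2 b3 (norm_nonneg _) (by norm_num)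
        linarith [norm_add_le (S' ((l : ℤ) - j + 1)) (S' ((l : ℤ) - j - 1))]
      calc _ ≤ 1 * (4 * E) := mul_le_mul c1 c3 (norm_nonneg _) zero_le_one
        _ = 4 * E := one_mul _
    calc _ ≤ ∑ j ∈ Finset.range M, ∑ l ∈ Finset.range M, 4 * E :=
          (norm_sum_le _ _).trans (Finset.sum_le_sum fun j hj =>
            (norm_sum_le _ _).trans (Finset.sum_le_sum fun l hl => hterm j hj l hl))
      _ = 4 * M ^ 2 * E := by simp; ring
  linarith [(abs_le.1 hbound).1]

theorem cos_two_pi_mul_le_of_forall_le {x δ : ℝ} (hδ0 : 0 ≤ δ)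
    (h : ∀ z : ℤ, δ ≤ |x - z|) : Real.cos (2 * Real.pi * x) ≤ Real.cos (2 * Real.pi * δ) := by
  have hr : |x - round x| ≤ 1 / 2 := abs_sub_round x
  have hpi := Real.pi_pos
  have e : Real.cos (2 * Real.pi * x) = Real.cos (2 * Real.pi * |x - round x|) := by
    rw [← Real.cos_abs (2 * Real.pi * |x - round x|), abs_mul, abs_abs, ← abs_mul, Real.cos_abs]
    rw [show 2 * Real.pi * (x - round x) = 2 * Real.pi * x - (round x : ℤ) * (2 * Real.pi) by ring,
      Real.cos_sub_int_mul_two_pi]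
  rw [e]
  apply Real.cos_le_cos_of_nonneg_of_le_pi (by positivity)
  · nlinarith
  · have := h (round x)
    gcongr

/-- If the exponential sums of `x` over the frequencies `1 ≤ |h| ≤ M` are small then a proportion at
least `1 / (4 M)` of the values of `x` lie within `δ` of an integer, for any `δ ≥ 1 / (M + 1)`. -/
theorem card_filter_near_int_ge {ι : Type*} (s : Finset ι) (x : ι → ℝ) {M : ℕ} (hM : 1 ≤ M)
    {δ E : ℝ} (hδ : δ ≤ 1 / 2) (hMδ : 1 ≤ δ * (M + 1)) (hEs : E * ((M : ℝ) + 1) ^ 6 ≤ 4 * s.card)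
    (hE : ∀ h : ℤ, h ≠ 0 → |h| ≤ M → ‖∑ k ∈ s, 𝐞 (h * x k)‖ ≤ E)
    [DecidablePred fun k => ∃ z : ℤ, |x k - z| < δ] :
    (s.card : ℝ) ≤ 4 * M * (s.filter fun k => ∃ z : ℤ, |x k - z| < δ).card := by
  have hM' : (1 : ℝ) ≤ M := by exact_mod_cast hM
  have hδ0 : 0 < δ := by
    by_contra h
    nlinarith
  have hE0 : 0 ≤ E := (norm_nonneg _).trans (hE 1 one_ne_zero (by
    rw [abs_one]; exact_mod_cast hM))
  have hpi := Real.pi_pos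
  set W := ∑ j ∈ Finset.range M, fejerCoeff M j ^ 2 with hW
  have hW4 := four_le_sq_mul_sum_sq_fejerCoeff hM
  rw [← hW] at hW4
  have hW0 : 0 < W := by
    by_contra h
    have : 0 < ((M : ℝ) + 1) ^ 2 := by positivity
    nlinarith
  have hlow := sum_fejerKernel_mul_ge s x M (2 * Real.pi * δ) E hE
  rw [← hW] at hlow
  set D := 1 - Real.cos (2 * Real.pi * δ) with hD
  have hu0 : 0 ≤ Real.cos (Real.pi * δ) := by
    apply Real.cos_nonneg_of_neg_pi_div_two_le_of_le <;> nlinarith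
  have hu1 := Real.cos_le_one (Real.pi * δ)
  have hDu : D = 2 - 2 * Real.cos (Real.pi * δ) ^ 2 := by
    rw [hD, show 2 * Real.pi * δ = 2 * (Real.pi * δ) by ring, Real.cos_two_mul]
    ring
  have hD8 : 8 * δ ^ 2 ≤ D := by
    have h1 := Real.mul_le_sin (x := Real.pi * δ) (by positivity) (by nlinarith)
    have h2 : 2 / Real.pi * (Real.pi * δ) = 2 * δ := by field_simp
    rw [h2] at h1
    have h3 := Real.sin_sq_add_cos_sq (Real.pi * δ)
    nlinarith
  have hθ : Real.cos (Real.pi * δ) ≤ Real.cos (Real.pi / (M + 1)) := by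
    apply Real.cos_le_cos_of_nonneg_of_le_pi (by positivity) (by nlinarith)
    rw [div_le_iff₀ (by positivity)]
    nlinarith
  -- `π / (M + 1) ≤ π δ`, half of the angle `2 π δ`, so half of `D` survives in the main term.
  have hcos : D / 2 ≤ Real.cos (Real.pi / (M + 1)) - Real.cos (2 * Real.pi * δ) := by
    have : Real.cos (2 * Real.pi * δ) = 1 - D := by rw [hD]; ring
    rw [this, hDu]
    nlinarith
  have hup : ∑ k ∈ s, fejerKernel M (x k) *
      (2 * Real.cos (2 * Real.pi * x k) - 2 * Real.cos (2 * Real.pi * δ)) ≤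
      (s.filter fun k => ∃ z : ℤ, |x k - z| < δ).card * (M * W * (2 * D)) := by
    have hle : ∀ k ∈ s, fejerKernel M (x k) *
        (2 * Real.cos (2 * Real.pi * x k) - 2 * Real.cos (2 * Real.pi * δ)) ≤
        if ∃ z : ℤ, |x k - z| < δ then M * W * (2 * D) else 0 := by
      intro k _
      have hk0 : 0 ≤ fejerKernel M (x k) := by unfold fejerKernel; positivity
      split_ifs with h
      · have h1 : 2 * Real.cos (2 * Real.pi * x k) - 2 * Real.cos (2 * Real.pi * δ) ≤ 2 * D := by
          rw [hD]
          linarith [Real.cos_le_one (2 * Real.pi * x k)]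
        calc _ ≤ fejerKernel M (x k) * (2 * D) := mul_le_mul_of_nonneg_left h1 hk0
          _ ≤ M * W * (2 * D) :=
            mul_le_mul_of_nonneg_right (fejerKernel_le M _) (by nlinarith)
      · push Not at h
        have := cos_two_pi_mul_le_of_forall_le hδ0.le h
        nlinarith
    refine (Finset.sum_le_sum hle).trans (le_of_eq ?_)
    rw [← Finset.sum_filter, Finset.sum_const, nsmul_eq_mul]
  set c : ℝ := ((s.filter fun k => ∃ z : ℤ, |x k - z| < δ).card : ℝ) with hc
  have hN0 : (0 : ℝ) ≤ s.card := by positivity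
  have hmain : s.card * (D * W) - 4 * M ^ 2 * E ≤ c * (M * W * (2 * D)) := by
    refine le_trans ?_ (hlow.trans hup)
    have : s.card * (D * W) ≤ s.card * (2 * (Real.cos (Real.pi / (M + 1)) -
      Real.cos (2 * Real.pi * δ)) * W) := by
      apply mul_le_mul_of_nonneg_left _ hN0
      apply mul_le_mul_of_nonneg_right _ hW0.le
      linarith
    linarith
  -- `D * W ≥ 32 / (M + 1) ^ 4`, so the error term is at most half of the main term.
  have hDW : 32 ≤ D * W * (M + 1) ^ 4 := by
    have h1 : 8 ≤ D * (M + 1) ^ 2 := by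
      have : 1 ≤ (δ * (M + 1)) ^ 2 := one_le_pow₀ hMδ
      nlinarith [sq_nonneg ((M : ℝ) + 1)]
    calc (32 : ℝ) = 8 * 4 := by norm_num
      _ ≤ (D * (M + 1) ^ 2) * (((M : ℝ) + 1) ^ 2 * W) := mul_le_mul h1 hW4 (by norm_num)
          (by positivity)
      _ = _ := by ring
  have herr : 4 * M ^ 2 * E ≤ s.card * (D * W) / 2 := by
    have hm4 : 0 < ((M : ℝ) + 1) ^ 4 := by positivity
    have h1 : (M : ℝ) ^ 2 ≤ (M + 1) ^ 2 := by gcongr; linarith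
    have h2 : 4 * M ^ 2 * E * (M + 1) ^ 4 ≤ 16 * s.card := by
      calc 4 * (M : ℝ) ^ 2 * E * (M + 1) ^ 4 ≤ 4 * (M + 1) ^ 2 * E * (M + 1) ^ 4 := by gcongr
        _ = 4 * (E * (M + 1) ^ 6) := by ring
        _ ≤ 4 * (4 * s.card) := by gcongr
        _ = _ := by ring
    have h3 : 16 * (s.card : ℝ) ≤ s.card * (D * W) / 2 * (M + 1) ^ 4 := by
      linarith [mul_le_mul_of_nonneg_left hDW hN0]
    exact le_of_mul_le_mul_right (h2.trans h3) hm4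
  have hDpos : 0 < D := (by positivity : 0 < 8 * δ ^ 2).trans_le hD8
  refine le_of_mul_le_mul_right (a := D * W) ?_ (mul_pos hDpos hW0)
  linarith

/-! ### Hitting sets -/

open Classical in
/-- Greedy hitting sets: if every member of a family of sets (indexed by `F`) fills a proportion at
least `ρ` of `U`, then some `n` points of `U` miss only a proportion `(1 - ρ) ^ n` of the family. -/
theorem exists_card_le_and_card_filter_not_hit_le {κ τ : Type*} (U : Finset κ) (hU : U.Nonempty)
    (F : Finset τ) (r : κ → τ → Prop) {ρ : ℝ} (hρ1 : ρ ≤ 1)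
    (hr : ∀ t ∈ F, ρ * U.card ≤ (U.filter fun u => r u t).card) (n : ℕ) :
    ∃ P ⊆ U, P.card ≤ n ∧
      ((F.filter fun t => ∀ u ∈ P, ¬ r u t).card : ℝ) ≤ (1 - ρ) ^ n * F.card := by
  induction n with
  | zero => exact ⟨∅, by simp, by simp, by simp⟩
  | succ n ih =>
    obtain ⟨P, hPU, hPn, hP⟩ := ih
    set G := F.filter fun t => ∀ u ∈ P, ¬ r u t with hG
    have hdc : ∑ u ∈ U, ((G.filter fun t => r u t).card : ℝ) =
        ∑ t ∈ G, ((U.filter fun u => r u t).card : ℝ) := by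
      have := Finset.sum_card_bipartiteAbove_eq_sum_card_bipartiteBelow (s := U) (t := G) r
      exact_mod_cast this
    have hsum : ∑ u ∈ U, ρ * (G.card : ℝ) ≤ ∑ u ∈ U, ((G.filter fun t => r u t).card : ℝ) := by
      rw [hdc, Finset.sum_const, nsmul_eq_mul]
      calc (U.card : ℝ) * (ρ * G.card) = ∑ t ∈ G, ρ * U.card := by
            rw [Finset.sum_const, nsmul_eq_mul]; ring
        _ ≤ _ := Finset.sum_le_sum fun t ht => hr t (Finset.mem_filter.1 ht).1
    obtain ⟨u, hu, hur⟩ := Finset.exists_le_of_sum_le hU hsum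
    refine ⟨insert u P, Finset.insert_subset hu hPU,
      (Finset.card_insert_le _ _).trans (by omega), ?_⟩
    have hsplit := Finset.card_filter_add_card_filter_not (s := G) (fun t => r u t)
    have heq : F.filter (fun t => ∀ v ∈ insert u P, ¬ r v t) = G.filter fun t => ¬ r u t := by
      ext t
      simp only [hG, Finset.mem_filter, Finset.forall_mem_insert]
      tauto
    rw [heq]
    have hsplit' : ((G.filter fun t => r u t).card : ℝ) + (G.filter fun t => ¬ r u t).card
      = G.card := by exact_mod_cast hsplit
    rw [pow_succ]
    nlinarith

/-! ### Intervals on the torus -/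

/-- A torus interval of positive measure `ε` contains an arc of radius `ε / 8`. -/
theorem IsTorusInterval.exists_arc_subset {J : Set UnitAddCircle} (hJ : IsTorusInterval J) {ε : ℝ}
    (hε : 0 < ε) (hvol : MeasureTheory.volume J = ENNReal.ofReal ε) :
    ∃ c : ℝ, ∀ t : ℝ, (∃ z : ℤ, |t - c - z| ≤ ε / 8) → (t : UnitAddCircle) ∈ J := by
  obtain ⟨I, hI, rfl⟩ := hJ
  have harc : ∀ a ∈ I, ∀ b ∈ I, a + ε / 4 ≤ b → ∃ c : ℝ, ∀ t : ℝ,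
      (∃ z : ℤ, |t - c - z| ≤ ε / 8) →
        (t : UnitAddCircle) ∈ (fun t : ℝ => (t : UnitAddCircle)) '' I := by
    intro a ha b hb hab
    refine ⟨a + ε / 8, ?_⟩
    rintro t ⟨z, hz⟩
    rw [abs_le] at hz
    refine ⟨t - z, hI.out ha hb ⟨by linarith, by linarith⟩, ?_⟩
    have hz0 : ((z : ℝ) : UnitAddCircle) = 0 :=
      (AddCircle.coe_eq_zero_iff 1).2 ⟨z, by simp⟩
    simp only [AddCircle.coe_sub, hz0, sub_zero]
  by_contra hcon
  have hne : I.Nonempty := by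
    rw [Set.nonempty_iff_ne_empty]
    rintro rfl
    simp only [Set.image_empty, MeasureTheory.measure_empty] at hvol
    exact absurd (ENNReal.ofReal_eq_zero.1 hvol.symm) (not_le.2 hε)
  obtain ⟨a, ha⟩ := hne
  have hsub : (fun t : ℝ => (t : UnitAddCircle)) '' I ⊆
      Metric.closedBall (a : UnitAddCircle) (ε / 4) := by
    rintro _ ⟨u, hu, rfl⟩
    have h1 : u < a + ε / 4 := lt_of_not_ge fun h => hcon (harc a ha u hu h)
    have h2 : a < u + ε / 4 := lt_of_not_ge fun h => hcon (harc u hu a ha h)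
    rw [Metric.mem_closedBall, dist_eq_norm]
    simp only [← AddCircle.coe_sub]
    have h3 : |u - a| ≤ ε / 4 := by rw [abs_le]; constructor <;> linarith
    refine le_trans ?_ h3
    rw [UnitAddCircle.norm_eq]
    simpa using round_le (u - a) 0
  have hle := MeasureTheory.measure_mono (μ := MeasureTheory.volume) hsub
  rw [hvol, AddCircle.volume_closedBall, ENNReal.ofReal_le_ofReal_iff (by positivity)] at hle
  have := hle.trans (min_le_right _ _)
  linarith

/-! ### Polynomial values near the integers -/

/-- The values of a polynomial of degree `p` whose leading coefficient is `1 / (q * p!)`, `p = d + 1`, on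
`[0, q ^ 2)` are within `δ` of an integer with frequency at least of order `δ`. -/
theorem sq_le_card_filter_polynomial_near_int {q : ℕ} (hq : q.Prime) {d M : ℕ} (hM : 1 ≤ M)
    (hqM : (2 * (M + 1) ^ 6) ^ (2 ^ d) ≤ q) {δ : ℝ} (hδ : δ ≤ 1 / 2) (hMδ : 1 ≤ δ * (M + 1))
    (f : Polynomial ℝ) (hf : f.natDegree ≤ d + 1)
    (hcoeff : f.coeff (d + 1) * (d + 1).factorial = 1 / q)
    [DecidablePred fun k : ℤ => ∃ z : ℤ, |f.eval (k : ℝ) - z| < δ] :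
    (q : ℝ) ^ 2 ≤ 4 * M * ((Finset.Ico (0 : ℤ) ((q ^ 2 : ℕ) : ℤ)).filter
      fun k : ℤ => ∃ z : ℤ, |f.eval (k : ℝ) - z| < δ).card := by
  have hcard : (Finset.Ico (0 : ℤ) ((q ^ 2 : ℕ) : ℤ)).card = q ^ 2 := by
    rw [Int.card_Ico, sub_zero, Int.toNat_natCast]
  have hR1 : (1 : ℝ) ≤ 2 * ((M : ℝ) + 1) ^ 6 := by
    have : (1 : ℝ) ≤ ((M : ℝ) + 1) ^ 6 := one_le_pow₀ (by linarith [Nat.cast_nonneg (α := ℝ) M])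
    linarith
  have hMq : (M : ℤ) < q := by
    have h1 : M + 1 ≤ (2 * (M + 1) ^ 6) ^ (2 ^ d) :=
      calc M + 1 ≤ (M + 1) ^ 6 := Nat.le_self_pow (by norm_num) _
        _ ≤ 2 * (M + 1) ^ 6 := by omega
        _ ≤ _ := Nat.le_self_pow (by positivity) _
    exact_mod_cast h1.trans hqM
  have hmain := card_filter_near_int_ge (Finset.Ico (0 : ℤ) ((q ^ 2 : ℕ) : ℤ))
    (fun k => f.eval (k : ℝ)) hM (E := 5 * q ^ 2 / (2 * ((M : ℝ) + 1) ^ 6)) hδ hMδ (by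
      rw [hcard]
      push_cast
      have h6 : ((M : ℝ) + 1) ^ 6 ≠ 0 := by positivity
      have : 5 * (q : ℝ) ^ 2 / (2 * ((M : ℝ) + 1) ^ 6) * (M + 1) ^ 6 = 5 / 2 * q ^ 2 := by
        field_simp
      rw [this]
      nlinarith [sq_nonneg (q : ℝ)]) (by
      intro h h0 hhM
      have := norm_sum_expTwoPiI_polynomial_le hq d _ hR1 (by exact_mod_cast hqM)
        (Polynomial.C (h : ℝ) * f) h ((Polynomial.natDegree_C_mul_le _ _).trans hf)
        (by rw [Polynomial.coeff_C_mul, mul_assoc, hcoeff]; ring)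
        (fun hd => h0 (Int.eq_zero_of_abs_lt_dvd hd (by omega))) 0 ((q ^ 2 : ℕ) : ℤ) (by simp)
      simpa using this)
  rw [hcard] at hmain
  exact_mod_cast hmain

/-- The polynomial `a X ^ p + ∑ i < p, b i X ^ i`. -/
noncomputable def polynomialOfCoeffs {p : ℕ} (a : ℝ) (b : Fin p → ℝ) : Polynomial ℝ :=
  Polynomial.C a * Polynomial.X ^ p + ∑ i : Fin p, Polynomial.C (b i) * Polynomial.X ^ (i : ℕ)

theorem natDegree_polynomialOfCoeffs_le {p : ℕ} (a : ℝ) (b : Fin p → ℝ) :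
    (polynomialOfCoeffs a b).natDegree ≤ p := by
  refine Polynomial.natDegree_add_le_of_degree_le (Polynomial.natDegree_C_mul_X_pow_le _ _) ?_
  exact Polynomial.natDegree_sum_le_of_forall_le _ _ fun i _ =>
    (Polynomial.natDegree_C_mul_X_pow_le _ _).trans i.2.le

theorem coeff_polynomialOfCoeffs {p : ℕ} (a : ℝ) (b : Fin p → ℝ) :
    (polynomialOfCoeffs a b).coeff p = a := by
  unfold polynomialOfCoeffs
  rw [Polynomial.coeff_add, Polynomial.finsetSum_coeff, Finset.sum_eq_zero fun i _ => by
    rw [Polynomial.coeff_C_mul_X_pow, if_neg i.2.ne']]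
  simp

theorem eval_polynomialOfCoeffs {p : ℕ} (a : ℝ) (b : Fin p → ℝ) (x : ℝ) :
    (polynomialOfCoeffs a b).eval x = a * x ^ p + ∑ i : Fin p, b i * x ^ (i : ℕ) := by
  simp [polynomialOfCoeffs, Polynomial.eval_finsetSum]

/-- Modulo `1`, real coefficients may be rounded to multiples of `1 / L` in `[0, 1)`. -/
theorem exists_net_coeff {p L : ℕ} (hL : 0 < L) (b : Fin p → ℝ) {N : ℕ} (hN : 1 ≤ N) :
    ∃ v : Fin p → Fin L, ∀ k ∈ Finset.Ico (0 : ℤ) N, ∃ z : ℤ,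
      |∑ i : Fin p, b i * (k : ℝ) ^ (i : ℕ) - ∑ i : Fin p, ((v i : ℕ) : ℝ) / L * (k : ℝ) ^ (i : ℕ)
        - z| ≤ p * N ^ p / L := by
  have hL' : (0 : ℝ) < L := by exact_mod_cast hL
  have hpos : ∀ i, 0 ≤ Int.fract (b i) * L := fun i =>
    mul_nonneg (Int.fract_nonneg _) hL'.le
  refine ⟨fun i => ⟨⌊Int.fract (b i) * L⌋₊, ?_⟩, fun k hk => ⟨∑ i : Fin p, ⌊b i⌋ * k ^ (i : ℕ), ?_⟩⟩
  · rw [Nat.floor_lt (hpos i)]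
    nlinarith [Int.fract_lt_one (b i)]
  · push_cast
    rw [← Finset.sum_sub_distrib, ← Finset.sum_sub_distrib]
    have hk0 : (0 : ℝ) ≤ k := by exact_mod_cast (Finset.mem_Ico.1 hk).1
    have hkN : (k : ℝ) ≤ N := by exact_mod_cast (Finset.mem_Ico.1 hk).2.le
    have hterm : ∀ i : Fin p, |b i * (k : ℝ) ^ (i : ℕ) -
        (⌊Int.fract (b i) * L⌋₊ : ℝ) / L * (k : ℝ) ^ (i : ℕ) - ⌊b i⌋ * (k : ℝ) ^ (i : ℕ)| ≤
        N ^ p / L := by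
      intro i
      have e : b i * (k : ℝ) ^ (i : ℕ) - (⌊Int.fract (b i) * L⌋₊ : ℝ) / L * (k : ℝ) ^ (i : ℕ)
          - ⌊b i⌋ * (k : ℝ) ^ (i : ℕ) =
          ((Int.fract (b i) * L - ⌊Int.fract (b i) * L⌋₊) / L) * (k : ℝ) ^ (i : ℕ) := by
        rw [sub_div, mul_div_cancel_right₀ _ hL'.ne', Int.fract]
        ring
      have h1 := Nat.floor_le (hpos i)
      have h2 := Nat.lt_floor_add_one (Int.fract (b i) * L)
      rw [e, abs_of_nonneg (mul_nonneg (div_nonneg (by linarith) hL'.le) (by positivity))]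
      have h3 : (k : ℝ) ^ (i : ℕ) ≤ N ^ p :=
        (pow_le_pow_left₀ hk0 hkN _).trans (pow_le_pow_right₀ (by exact_mod_cast hN) i.2.le)
      calc _ ≤ 1 / (L : ℝ) * N ^ p := by
            gcongr
            linarith
        _ = _ := by ring
    calc _ ≤ ∑ i : Fin p, (N : ℝ) ^ p / L :=
          (Finset.abs_sum_le_sum_abs _ _).trans (Finset.sum_le_sum fun i _ => hterm i)
      _ = _ := by simp; ring

/-- At most `n` integers on which every polynomial with leading coefficient `1 / (q * p!)`,
`p = d + 1`, takes a value within `2 δ` of an integer: one `δ` comes from the equidistribution, the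
other from rounding the lower-order coefficients to a net of `L ^ p` elements. -/
theorem exists_finset_polynomial_near_int {q : ℕ} (hq : q.Prime) {d M : ℕ} (hM : 1 ≤ M)
    (hqM : (2 * (M + 1) ^ 6) ^ (2 ^ d) ≤ q) {δ : ℝ} (hδ : δ ≤ 1 / 2) (hMδ : 1 ≤ δ * (M + 1))
    {L n : ℕ} (hL : 0 < L) (hLδ : (d + 1) * ((q : ℝ) ^ 2) ^ (d + 1) ≤ δ * L)
    (hn : (1 - 1 / (4 * M : ℝ)) ^ n * (L : ℝ) ^ (d + 1) < 1) :
    ∃ P : Finset ℤ, P.card ≤ n ∧ ∀ b : Fin (d + 1) → ℝ, ∃ k ∈ P, ∃ z : ℤ,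
      |1 / (q * (d + 1).factorial : ℝ) * (k : ℝ) ^ (d + 1) +
        ∑ i : Fin (d + 1), b i * (k : ℝ) ^ (i : ℕ) - z| ≤ 2 * δ := by
  classical
  have hq0 : (0 : ℝ) < q := by exact_mod_cast hq.pos
  have hL0 : (0 : ℝ) < L := by exact_mod_cast hL
  have hM0 : (1 : ℝ) ≤ M := by exact_mod_cast hM
  set A : ℝ := 1 / (q * (d + 1).factorial : ℝ) with hA
  set U := Finset.Ico (0 : ℤ) ((q ^ 2 : ℕ) : ℤ) with hU
  have hUcard : U.card = q ^ 2 := by rw [hU, Int.card_Ico, sub_zero, Int.toNat_natCast]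
  obtain ⟨P, hPU, hPn, hP⟩ := exists_card_le_and_card_filter_not_hit_le U
    (Finset.card_pos.1 (by rw [hUcard]; exact pow_pos hq.pos 2))
    (Finset.univ : Finset (Fin (d + 1) → Fin L))
    (fun k v => ∃ z : ℤ,
      |(polynomialOfCoeffs A fun i => ((v i : ℕ) : ℝ) / L).eval (k : ℝ) - z| < δ)
    (ρ := 1 / (4 * M)) (by
      rw [div_le_one (by positivity)]
      linarith) (by
      intro v _
      have := sq_le_card_filter_polynomial_near_int hq hM hqM hδ hMδ
        (polynomialOfCoeffs A fun i => ((v i : ℕ) : ℝ) / L) (natDegree_polynomialOfCoeffs_le _ _)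
        (by
          rw [coeff_polynomialOfCoeffs, hA]
          have : ((d + 1).factorial : ℝ) ≠ 0 := by exact_mod_cast (d + 1).factorial_ne_zero
          field_simp)
      rw [hUcard, one_div_mul_eq_div, div_le_iff₀ (by positivity)]
      push_cast
      linarith) n
  refine ⟨P, hPn, fun b => ?_⟩
  obtain ⟨v, hv⟩ := exists_net_coeff hL b (N := q ^ 2) (Nat.one_le_pow _ _ hq.pos)
  -- The number of missed members of the net is a natural number below `1`.
  have hempty : (Finset.univ.filter fun v : Fin (d + 1) → Fin L => ∀ k ∈ P, ¬ ∃ z : ℤ,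
      |(polynomialOfCoeffs A fun i => ((v i : ℕ) : ℝ) / L).eval (k : ℝ) - z| < δ) = ∅ := by
    rw [← Finset.card_eq_zero]
    have h1 : ((Finset.univ : Finset (Fin (d + 1) → Fin L)).card : ℝ) = (L : ℝ) ^ (d + 1) := by
      simp
    rw [h1] at hP
    have := hP.trans_lt hn
    exact Nat.lt_one_iff.1 (by exact_mod_cast this)
  have hvn : v ∉ (Finset.univ.filter fun v : Fin (d + 1) → Fin L => ∀ k ∈ P, ¬ ∃ z : ℤ,
      |(polynomialOfCoeffs A fun i => ((v i : ℕ) : ℝ) / L).eval (k : ℝ) - z| < δ) := by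
    rw [hempty]
    exact Finset.notMem_empty _
  simp only [Finset.mem_filter, Finset.mem_univ, true_and, not_forall, not_not] at hvn
  obtain ⟨k, hk, z, hz⟩ := hvn
  obtain ⟨z', hz'⟩ := hv k (hPU hk)
  refine ⟨k, hk, z + z', ?_⟩
  rw [eval_polynomialOfCoeffs] at hz
  have hle : ((d + 1 : ℕ) : ℝ) * ((q ^ 2 : ℕ) : ℝ) ^ (d + 1) / L ≤ δ := by
    rw [div_le_iff₀ hL0]
    exact_mod_cast hLδ
  have hz'' := hz'.trans hle
  rw [abs_le] at hz'' ⊢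
  rw [abs_lt] at hz
  push_cast
  constructor <;> linarith

/-! ### Choice of the parameters -/

theorem proposition4 (p : ℕ) (hp : 1 ≤ p) :
    ∃ K : ℝ, 0 < K ∧ ∃ n₀ : ℕ, ∀ n : ℕ, n₀ ≤ n →
      ∃ P : Finset ℤ, P.card = n ∧ ∃ A : ℝ, ∀ B : ℕ → ℝ, ∀ J : Set UnitAddCircle,
        IsTorusInterval J →
        MeasureTheory.volume J = ENNReal.ofReal (K * (Real.log (n : ℝ) / (n : ℝ))) →
        (((fun k : ℤ => ((A * (k : ℝ) ^ p + ∑ i ∈ Finset.Ico 1 p, B i * (k : ℝ) ^ i : ℝ) :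
            UnitAddCircle)) '' (P : Set ℤ)) ∩ J).Nonempty := by
  obtain ⟨d, rfl⟩ : ∃ d, p = d + 1 := ⟨p - 1, by omega⟩
  -- `q ≤ n ^ a`, and the net of lower-order coefficients has at most `n ^ D` elements.
  set a : ℕ := 7 * 2 ^ d + 1 with ha
  set D : ℕ := (2 * a * (d + 1) + 2) * (d + 1) with hD
  have hK : (0 : ℝ) < 128 * (D + 1) := by positivity
  have hlim : ∀ᶠ n : ℕ in Filter.atTop, Real.log (n : ℝ) ≤ 1 / (16 * (D + 1)) * n := by
    have h2 := tendsto_natCast_atTop_atTop.eventually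
      (Real.isLittleO_log_id_atTop.bound (by positivity : (0 : ℝ) < 1 / (16 * (D + 1))))
    filter_upwards [h2] with n hn
    have := (Real.le_norm_self _).trans hn
    simpa using this
  obtain ⟨n₁, hn₁⟩ := Filter.eventually_atTop.1 hlim
  refine ⟨128 * (D + 1), hK, max n₁ (max 3 (d + 1)), fun n hn => ?_⟩
  have hlog := hn₁ n ((le_max_left _ _).trans hn)
  have hn3 : 3 ≤ n := (le_max_left _ _).trans ((le_max_right _ _).trans hn)
  have hnd : d + 1 ≤ n := (le_max_right _ _).trans ((le_max_right _ _).trans hn)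
  have hn3' : (3 : ℝ) ≤ n := by exact_mod_cast hn3
  have hn0 : (0 : ℝ) < n := by linarith
  have hlog1 : 1 ≤ Real.log n := by
    rw [Real.le_log_iff_exp_le hn0]
    linarith [Real.exp_one_lt_d9]
  set ε : ℝ := 128 * (D + 1) * (Real.log n / n) with hε
  have hε0 : 0 < ε := by positivity
  set δ : ℝ := ε / 16 with hδ
  have hδ0 : 0 < δ := by positivity
  have hδn : δ * n = 8 * (D + 1) * Real.log n := by
    rw [hδ, hε]
    field_simp
    ring
  have hD0 : (0 : ℝ) ≤ D := Nat.cast_nonneg _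
  have hδ2 : δ ≤ 1 / 2 := by
    refine le_of_mul_le_mul_right ?_ hn0
    rw [hδn]
    have : 8 * ((D : ℝ) + 1) * Real.log n ≤ 8 * (D + 1) * (1 / (16 * (D + 1)) * n) := by gcongr
    refine this.trans (le_of_eq ?_)
    field_simp
    norm_num
  set M : ℕ := ⌈1 / δ⌉₊ with hMdef
  have hM : 1 ≤ M := Nat.ceil_pos.2 (by positivity)
  have hM1 : 1 / δ ≤ M := Nat.le_ceil _
  have hM2 : (M : ℝ) < 1 / δ + 1 := Nat.ceil_lt_add_one (by positivity)
  have hM0 : (0 : ℝ) < M := by exact_mod_cast hM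
  have hMδ : 1 ≤ δ * (M + 1) := by
    rw [div_le_iff₀ hδ0] at hM1
    linarith
  have hMδ2 : δ * M ≤ 2 := by
    have : δ * M ≤ δ * (1 / δ + 1) := by gcongr
    rw [mul_add, mul_one_div_cancel hδ0.ne'] at this
    linarith
  have hMn : M + 1 ≤ n := by
    have h8 : 8 ≤ δ * n := by
      rw [hδn]
      nlinarith
    have h1 : 1 / δ ≤ n / 8 := by
      rw [div_le_iff₀ hδ0]
      linarith
    have : (M : ℝ) < n := by linarith
    exact_mod_cast this
  obtain ⟨q, hq, hqlow, hqup⟩ := Nat.exists_prime_lt_and_le_two_mul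
    ((2 * (M + 1) ^ 6) ^ (2 ^ d)) (by positivity)
  have hqn : q ≤ n ^ a := by
    have h1 : 2 * (M + 1) ^ 6 ≤ n ^ 7 := by
      calc 2 * (M + 1) ^ 6 ≤ n * n ^ 6 := by gcongr; omega
        _ = n ^ 7 := by ring
    calc q ≤ 2 * (2 * (M + 1) ^ 6) ^ (2 ^ d) := hqup
      _ ≤ n * (n ^ 7) ^ (2 ^ d) := by gcongr; omega
      _ = n ^ a := by rw [ha, ← pow_mul]; ring
  set L : ℕ := (q ^ 2) ^ (d + 1) * n ^ 2 with hLdef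
  have hL : 0 < L := by
    have := hq.pos
    positivity
  have hLn : L ^ (d + 1) ≤ n ^ D := by
    calc L ^ (d + 1) ≤ (((n ^ a) ^ 2) ^ (d + 1) * n ^ 2) ^ (d + 1) := by
          rw [hLdef]; gcongr
      _ = n ^ D := by
          rw [← pow_mul, ← pow_mul, ← pow_add, ← pow_mul, hD]
          congr 1
          ring
  have hLδ : ((d : ℝ) + 1) * ((q : ℝ) ^ 2) ^ (d + 1) ≤ δ * L := by
    have h1 : 1 ≤ δ * n := by
      have : (M : ℝ) + 1 ≤ n := by exact_mod_cast hMn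
      nlinarith
    have h2 : (d : ℝ) + 1 ≤ n := by exact_mod_cast hnd
    have h3 : (d : ℝ) + 1 ≤ δ * n * n := by nlinarith
    rw [hLdef]
    push_cast
    calc _ ≤ (δ * n * n) * ((q : ℝ) ^ 2) ^ (d + 1) := by gcongr
      _ = _ := by ring
  -- `n / (4 M) ≥ n δ / 8 = (D + 1) log n`, against a net of at most `n ^ D` elements.
  have hprob : (1 - 1 / (4 * M : ℝ)) ^ n * (L : ℝ) ^ (d + 1) < 1 := by
    have h1 : (1 - 1 / (4 * M : ℝ)) ^ n ≤ Real.exp (-((D + 1) * Real.log n)) := by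
      have h0 : 0 ≤ 1 - 1 / (4 * M : ℝ) := by
        have : (1 : ℝ) ≤ M := by exact_mod_cast hM
        rw [sub_nonneg, div_le_one (by positivity)]
        linarith
      have h2 : 1 - 1 / (4 * M : ℝ) ≤ Real.exp (-(1 / (4 * M : ℝ))) := by
        linarith [Real.add_one_le_exp (-(1 / (4 * M : ℝ)))]
      refine (pow_le_pow_left₀ h0 h2 n).trans ?_
      rw [← Real.exp_nat_mul, Real.exp_le_exp]
      have h3 : (D + 1) * Real.log n ≤ n * (1 / (4 * M : ℝ)) := by
        rw [mul_one_div, le_div_iff₀ (by positivity)]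
        nlinarith
      linarith
    have h2 : (L : ℝ) ^ (d + 1) ≤ Real.exp (D * Real.log n) := by
      rw [Real.exp_nat_mul, Real.exp_log hn0]
      exact_mod_cast hLn
    calc _ ≤ Real.exp (-((D + 1) * Real.log n)) * Real.exp (D * Real.log n) := by gcongr
      _ = Real.exp (-Real.log n) := by rw [← Real.exp_add]; ring_nf
      _ < 1 := Real.exp_zero ▸ Real.exp_lt_exp.2 (by linarith)
  obtain ⟨P₀, hP₀n, hP₀⟩ := exists_finset_polynomial_near_int hq hM hqlow.le hδ2 hMδ hL hLδ hprob
  obtain ⟨P, hPP, hPn⟩ := Infinite.exists_superset_card_eq P₀ n hP₀n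
  refine ⟨P, hPn, 1 / (q * (d + 1).factorial : ℝ), fun B J hJ hvol => ?_⟩
  obtain ⟨c, hc⟩ := hJ.exists_arc_subset hε0 hvol
  -- The centre of the arc plays the role of a constant coefficient.
  obtain ⟨k, hk, z, hz⟩ := hP₀ fun i => if (i : ℕ) = 0 then -c else B i
  refine ⟨_, ⟨k, hPP hk, rfl⟩, hc _ ⟨z, ?_⟩⟩
  have hsum : ∑ i : Fin (d + 1), (if (i : ℕ) = 0 then -c else B i) * (k : ℝ) ^ (i : ℕ) =
      ∑ i ∈ Finset.Ico 1 (d + 1), B i * (k : ℝ) ^ i - c := by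
    rw [Fin.sum_univ_eq_sum_range (fun i => (if i = 0 then -c else B i) * (k : ℝ) ^ i) (d + 1),
      Finset.range_eq_Ico, Finset.sum_eq_sum_Ico_succ_bot (Nat.succ_pos d)]
    rw [Finset.sum_congr rfl fun i hi => by
      rw [if_neg (by have := (Finset.mem_Ico.1 hi).1; omega)]]
    simp
    ring
  rw [hsum] at hz
  have e : 2 * δ = ε / 8 := by rw [hδ]; ring
  rw [e] at hz
  refine le_trans (le_of_eq ?_) hz
  congr 1
  ring
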